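/- For a finite set $P\subset\mathbb R^d$ with at least two points, let $\min S(P)=\min_{p\in P}\sum_{q\in P}|pq|$ be the length of its minimum star and $SS^*(P)=\inf_{x\in\mathbb R^d}\sum_{q\in P}|xq|$ the length of its minimum Steiner star, where $|xq|$ is the Euclidean distance. The star Steiner ratio in $\mathbb R^d$ is $\rho_d=\sup_P \min S(P)/SS^*(P)$, over all such $P$. Let $c_d$ be the average Euclidean distance between two points of the unit sphere in $\mathbb R^d$, chosen independently and uniformly with respect to surface measure. Then for every integer $d\ge 2$ the supremum $\rho_d$ is finite, $1<c_d<2$, $$c_d\le\rho_d\le\frac{2\sqrt2-c_d}{1+\sqrt2-c_d},\qquad c_{d+2}=\frac{4d^2}{4d^2-1}\,c_d,$$ and $$\sqrt2\,e^{-\frac1{4(2d-3)}}\le\rho_d\le\frac{2\sqrt2-\sqrt2\,e^{-\frac1{5(2d-1)}}}{1+\sqrt2-\sqrt2\,e^{-\frac1{5(2d-1)}}}.$$ Moreover, $\lim_{d\to\infty}c_d=\lim_{d\to\infty}\rho_d=\sqrt2$. -/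

import Mathlib

open Real Set Filter Topology MeasureTheory

noncomputable section

/-- The length of the star which joins `x` to all points of `P`. -/
def starLength {d : ℕ} (P : Finset (EuclideanSpace ℝ (Fin d))) (x : EuclideanSpace ℝ (Fin d)) : ℝ :=
  ∑ p ∈ P, dist x p

/-- The length of a minimum star for `P` (the center is a point of `P`). -/
def minStar {d : ℕ} (P : Finset (EuclideanSpace ℝ (Fin d))) (hP : P.Nonempty) : ℝ :=
  P.inf' hP (starLength P)

/-- The length of a minimum Steiner star for `P` (the center is any point of the space). -/
def minSteinerStar {d : ℕ} (P : Finset (EuclideanSpace ℝ (Fin d))) : ℝ :=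
  ⨅ x : EuclideanSpace ℝ (Fin d), starLength P x

/-- The ratios between the lengths of the minimum star and the minimum Steiner star, over all
finite point sets of `ℝ^d` with at least two points (for one point, both lengths are zero). -/
def starRatios (d : ℕ) : Set ℝ :=
  {r | ∃ (P : Finset (EuclideanSpace ℝ (Fin d))) (hP : P.Nonempty),
    2 ≤ P.card ∧ r = minStar P hP / minSteinerStar P}

/-- The star Steiner ratio in `ℝ^d`. -/
def starSteinerRatio (d : ℕ) : ℝ := sSup (starRatios d)

/-- The surface measure of the unit sphere in `ℝ^d`. -/
def sphereMeasure (d : ℕ) : Measure (Metric.sphere (0 : EuclideanSpace ℝ (Fin d)) 1) :=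
  (volume : Measure (EuclideanSpace ℝ (Fin d))).toSphere

/-- The constant of uniform distribution: the average Euclidean distance between two points of the
unit sphere in `ℝ^d`, for the uniform distribution (`⨍` divides by the total mass). -/
def uniformConst (d : ℕ) : ℝ :=
  ⨍ x, ⨍ y, dist x y ∂(sphereMeasure d) ∂(sphereMeasure d)

end

/-! Lower bound for the ratio. Place `n` points on the unit sphere so that the sum of their
distances is maximal. No point can be moved profitably, so its star is at least the average over all
positions of that point, which is `(n - 1) * uniformConst d`, while the Steiner star centered at the
origin has length `n`. Letting `n` grow gives `uniformConst_le_starSteinerRatio`.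

Upper bound (`mul_minStar_le`). If a minimizing Steiner center `o` is not in `P`, the unit vectors
from `o` towards `P` sum to zero. The star at the point nearest to `o` is controlled by this
balance, which bounds an average distance by `√2`. The average of all stars is controlled by
`sum_dist_le_uniformConst`: on the sphere no configuration has a larger mean distance than the
uniform distribution. This follows since distance is of negative type (`sum_mul_mul_dist_nonpos`). A
convex combination of both estimates gives the bound.

Asymptotics. The law of a coordinate on the sphere turns the constant into a quotient of integrals
of powers of the sine (`uniformConst_add_two`), from which the recursion and the limit `√2` follow.
The exponential bounds come from the recursion by monotonicity towards that limit. -/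

/-! ### Distance as a kernel of negative type. -/

theorem intervalIntegral_indicator_Iic_one {M t : ℝ} (ht : |t| ≤ M) :
    ∫ x in (-M)..M, (Iic t).indicator (fun _ ↦ (1 : ℝ)) x = t + M := by
  obtain ⟨h1, h2⟩ := abs_le.1 ht
  rw [intervalIntegral.integral_of_le (by linarith), integral_indicator measurableSet_Iic,
    Measure.restrict_restrict measurableSet_Iic]
  have : Iic t ∩ Ioc (-M) M = Ioc (-M) t := by
    ext x; simp only [mem_inter_iff, mem_Iic, mem_Ioc]
    exact ⟨fun h ↦ ⟨h.2.1, h.1⟩, fun h ↦ ⟨h.2, h.1, h.2.trans h2⟩⟩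
  rw [this]
  simp
  linarith

theorem intervalIntegrable_indicator_Iic_one (a b t : ℝ) :
    IntervalIntegrable ((Iic t).indicator (fun _ ↦ (1 : ℝ))) volume a b := by
  refine Antitone.intervalIntegrable fun x y hxy ↦ ?_
  by_cases hy : y ≤ t
  · simp [hy, hxy.trans hy]
  · simp only [indicator, mem_Iic, hy, if_false]
    split_ifs <;> norm_num

/-- Up to terms in `t i` or `t j` alone, which the condition on `a` kills, the kernel is `-2 * min
(t i) (t j)`. The minimum, shifted by `M`, is the `L²` inner product of indicators of half-lines on
`(-M, M)`, so its quadratic form is the integral of a square. -/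
theorem sum_mul_mul_abs_sub_nonpos {ι : Type*} (s : Finset ι) (a t : ι → ℝ)
    (ha : ∑ i ∈ s, a i = 0) : ∑ i ∈ s, ∑ j ∈ s, a i * a j * |t i - t j| ≤ 0 := by
  obtain ⟨M, hM⟩ : ∃ M, ∀ i ∈ s, |t i| ≤ M :=
    ⟨∑ i ∈ s, |t i|, fun i hi ↦ Finset.single_le_sum (f := fun i ↦ |t i|)
      (fun _ _ ↦ abs_nonneg _) hi⟩
  set χ : ℝ → ℝ → ℝ := fun t ↦ (Iic t).indicator (fun _ ↦ (1 : ℝ)) with hχ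
  have hmul : ∀ u v x, χ u x * χ v x = χ (min u v) x := by
    intro u v x
    simp only [hχ, indicator, mem_Iic, le_min_iff]
    by_cases h1 : x ≤ u <;> by_cases h2 : x ≤ v <;> simp [h1, h2]
  have hint : ∀ i ∈ s, ∀ j ∈ s, ∫ x in (-M)..M, χ (t i) x * χ (t j) x = min (t i) (t j) + M := by
    intro i hi j hj
    simp_rw [hmul]
    refine intervalIntegral_indicator_Iic_one ?_
    rcases min_choice (t i) (t j) with h | h <;> rw [h]
    exacts [hM i hi, hM j hj]
  have hsq : ∑ i ∈ s, ∑ j ∈ s, a i * a j * (min (t i) (t j) + M)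
      = ∫ x in (-M)..M, (∑ i ∈ s, a i * χ (t i) x) ^ 2 := by
    have : ∀ x, (∑ i ∈ s, a i * χ (t i) x) ^ 2
        = ∑ i ∈ s, ∑ j ∈ s, a i * a j * (χ (t i) x * χ (t j) x) := by
      intro x
      rw [sq, Finset.sum_mul_sum]
      exact Finset.sum_congr rfl fun i _ ↦ Finset.sum_congr rfl fun j _ ↦ by ring
    simp_rw [this]
    have hI : ∀ i j, IntervalIntegrable (fun x ↦ a i * a j * (χ (t i) x * χ (t j) x))
        volume (-M) M := by
      intro i j
      simp_rw [hmul]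
      exact (intervalIntegrable_indicator_Iic_one _ _ _).const_mul _
    rw [intervalIntegral.integral_finsetSum fun i _ ↦ by
      simpa [Finset.sum_fn] using IntervalIntegrable.sum s fun j _ ↦ hI i j]
    refine Finset.sum_congr rfl fun i hi ↦ ?_
    rw [intervalIntegral.integral_finsetSum fun j _ ↦ hI i j]
    refine Finset.sum_congr rfl fun j hj ↦ ?_
    rw [intervalIntegral.integral_const_mul, hint i hi j hj]
  have hnn : 0 ≤ ∑ i ∈ s, ∑ j ∈ s, a i * a j * (min (t i) (t j) + M) := by
    rw [hsq]
    by_cases hM0 : -M ≤ M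
    · exact intervalIntegral.integral_nonneg hM0 fun x _ ↦ sq_nonneg _
    · have : s = ∅ := by
        refine Finset.eq_empty_of_forall_notMem fun i hi ↦ hM0 ?_
        have := (abs_nonneg _).trans (hM i hi)
        linarith
      simp [this]
  have habs : ∀ u v : ℝ, |u - v| = (u + M) + (v + M) - 2 * (min u v + M) := by
    intro u v
    rcases le_total u v with h | h
    · rw [abs_of_nonpos (by linarith), min_eq_left h]; ring
    · rw [abs_of_nonneg (by linarith), min_eq_right h]; ring
  have hA : ∑ i ∈ s, ∑ j ∈ s, a i * a j * (t i + M) = 0 := by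
    have : ∀ i ∈ s, ∑ j ∈ s, a i * a j * (t i + M) = 0 := by
      intro i _
      have : ∑ j ∈ s, a i * a j * (t i + M) = (a i * (t i + M)) * ∑ j ∈ s, a j := by
        rw [Finset.mul_sum]; exact Finset.sum_congr rfl fun j _ ↦ by ring
      rw [this, ha, mul_zero]
    exact Finset.sum_eq_zero this
  have hB : ∑ i ∈ s, ∑ j ∈ s, a i * a j * (t j + M) = 0 := by
    rw [Finset.sum_comm, ← hA]
    exact Finset.sum_congr rfl fun j _ ↦ Finset.sum_congr rfl fun i _ ↦ by ring
  have : ∑ i ∈ s, ∑ j ∈ s, a i * a j * |t i - t j|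
      = ∑ i ∈ s, ∑ j ∈ s, a i * a j * (t i + M) + ∑ i ∈ s, ∑ j ∈ s, a i * a j * (t j + M)
        - 2 * ∑ i ∈ s, ∑ j ∈ s, a i * a j * (min (t i) (t j) + M) := by
    simp_rw [Finset.mul_sum, ← Finset.sum_add_distrib, ← Finset.sum_sub_distrib]
    exact Finset.sum_congr rfl fun i _ ↦ Finset.sum_congr rfl fun j _ ↦ by rw [habs]; ring
  rw [this, hA, hB]
  linarith

section
variable {E : Type*} [NormedAddCommGroup E] [InnerProductSpace ℝ E]

theorem exists_linearIsometryEquiv_apply_eq {x y : E} (h : ‖x‖ = ‖y‖) :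
    ∃ L : E ≃ₗᵢ[ℝ] E, L x = y :=
  ⟨_, Submodule.reflection_sub h⟩

variable [FiniteDimensional ℝ E] [MeasurableSpace E] [BorelSpace E]

theorem integrableOn_ball_abs_inner (x : E) :
    IntegrableOn (fun w : E ↦ |inner ℝ x w|) (Metric.ball 0 1) := by
  have : ContinuousOn (fun w : E ↦ |inner ℝ x w|) (Metric.closedBall 0 1) := by fun_prop
  exact (this.integrableOn_compact (isCompact_closedBall _ _)).mono_set Metric.ball_subset_closedBall

/-- The integral is homogeneous and rotation invariant in `x`. It exhibits the norm as an average of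
one-dimensional absolute values, which reduces negative type to the real line. -/
theorem exists_pos_setIntegral_abs_inner :
    ∃ K : ℝ, 0 < K ∧ ∀ x : E, ∫ w in Metric.ball (0 : E) 1, |inner ℝ x w| = K * ‖x‖ := by
  rcases subsingleton_or_nontrivial E with hE | hE
  · exact ⟨1, one_pos, fun x ↦ by simp [Subsingleton.elim x 0]⟩
  obtain ⟨e, he⟩ := exists_norm_eq E zero_le_one
  refine ⟨∫ w in Metric.ball (0 : E) 1, |inner ℝ e w|, ?_, fun x ↦ ?_⟩
  · rw [setIntegral_pos_iff_support_of_nonneg_ae (.of_forall fun _ ↦ abs_nonneg _)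
      (integrableOn_ball_abs_inner e)]
    refine IsOpen.measure_pos _ (IsOpen.inter ?_ Metric.isOpen_ball) ⟨(1 / 2 : ℝ) • e, ?_, ?_⟩
    · exact Continuous.isOpen_support (by fun_prop)
    · simp [inner_smul_right, he]
    · simp [norm_smul, he]; norm_num
  · obtain ⟨L, hL⟩ := exists_linearIsometryEquiv_apply_eq (x := ‖x‖ • e) (y := x)
      (by simp [norm_smul, he])
    have hball : L ⁻¹' Metric.ball 0 1 = Metric.ball 0 1 := by
      ext w; simp
    rw [← L.measurePreserving.setIntegral_preimage_emb L.toHomeomorph.measurableEmbedding, hball,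
      mul_comm, ← integral_const_mul]
    refine integral_congr_ae (.of_forall fun w ↦ ?_)
    simp only
    conv_lhs => rw [← hL]
    rw [L.inner_map_map, real_inner_smul_left, abs_mul, abs_norm]

/-- The Euclidean distance is a kernel of negative type. -/
theorem sum_mul_mul_dist_nonpos {ι : Type*} (s : Finset ι) (a : ι → ℝ) (x : ι → E)
    (ha : ∑ i ∈ s, a i = 0) : ∑ i ∈ s, ∑ j ∈ s, a i * a j * dist (x i) (x j) ≤ 0 := by
  obtain ⟨K, hK, hKx⟩ := exists_pos_setIntegral_abs_inner (E := E)
  have hI : ∀ i j, IntegrableOn (fun w ↦ a i * a j * |inner ℝ (x i - x j) w|)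
      (Metric.ball (0 : E) 1) :=
    fun i j ↦ (integrableOn_ball_abs_inner _).const_mul _
  have : K * ∑ i ∈ s, ∑ j ∈ s, a i * a j * dist (x i) (x j)
      = ∫ w in Metric.ball (0 : E) 1, ∑ i ∈ s, ∑ j ∈ s, a i * a j * |inner ℝ (x i - x j) w| := by
    rw [integral_finsetSum _ fun i _ ↦ integrable_finsetSum _ fun j _ ↦ hI i j, Finset.mul_sum]
    refine Finset.sum_congr rfl fun i _ ↦ ?_
    rw [integral_finsetSum _ fun j _ ↦ hI i j, Finset.mul_sum]
    refine Finset.sum_congr rfl fun j _ ↦ ?_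
    rw [integral_const_mul, hKx, dist_eq_norm]
    ring
  have hle : K * ∑ i ∈ s, ∑ j ∈ s, a i * a j * dist (x i) (x j) ≤ 0 := by
    rw [this]
    refine integral_nonpos fun w ↦ ?_
    simp_rw [inner_sub_left]
    exact sum_mul_mul_abs_sub_nonpos s a (fun i ↦ inner ℝ (x i) w) ha
  exact nonpos_of_mul_nonpos_right hle hK
end

/-! ### Uniform distribution on the sphere and its invariance. -/

/-- The uniform probability distribution on the unit sphere of `ℝ^d`. -/
noncomputable def uniformSphere (d : ℕ) :
    Measure (Metric.sphere (0 : EuclideanSpace ℝ (Fin d)) 1) :=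
  (sphereMeasure d univ)⁻¹ • sphereMeasure d

instance (d : ℕ) : IsFiniteMeasure (sphereMeasure d) := by
  unfold sphereMeasure; infer_instance

instance (d : ℕ) [NeZero d] : NeZero (sphereMeasure d) :=
  ⟨by unfold sphereMeasure; exact Measure.toSphere_ne_zero _⟩

instance (d : ℕ) [NeZero d] : IsProbabilityMeasure (uniformSphere d) := by
  unfold uniformSphere; infer_instance

theorem uniformConst_eq_integral (d : ℕ) :
    uniformConst d = ∫ x, ∫ y, dist x y ∂uniformSphere d ∂uniformSphere d := rfl

section
variable {E : Type*} [NormedAddCommGroup E] [InnerProductSpace ℝ E]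

/-- The restriction of a linear isometry to the unit sphere. -/
def LinearIsometryEquiv.unitSphereMap (L : E ≃ₗᵢ[ℝ] E) (x : Metric.sphere (0 : E) 1) :
    Metric.sphere (0 : E) 1 :=
  ⟨L x, by simp⟩

theorem LinearIsometryEquiv.continuous_unitSphereMap (L : E ≃ₗᵢ[ℝ] E) :
    Continuous L.unitSphereMap :=
  (L.continuous.comp continuous_subtype_val).subtype_mk _

variable [FiniteDimensional ℝ E] [MeasurableSpace E] [BorelSpace E]

-- `toSphere` measures a set by the volume of the cone over it, and a linear isometry carries cones
-- to cones and preserves volume.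
open scoped Pointwise in
theorem LinearIsometryEquiv.measurePreserving_unitSphereMap (L : E ≃ₗᵢ[ℝ] E) :
    MeasurePreserving L.unitSphereMap (volume : Measure E).toSphere
      (volume : Measure E).toSphere := by
  refine ⟨L.continuous_unitSphereMap.measurable, ?_⟩
  ext s hs
  have hm := L.continuous_unitSphereMap.measurable
  rw [Measure.map_apply hm hs, Measure.toSphere_apply' _ (hm hs), Measure.toSphere_apply' _ hs]
  congr 1
  have : Ioo (0 : ℝ) 1 • ((↑) '' (L.unitSphereMap ⁻¹' s) : Set E)
      = L ⁻¹' (Ioo (0 : ℝ) 1 • ((↑) '' s)) := by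
    ext w
    simp only [mem_preimage, Set.mem_smul, mem_image]
    constructor
    · rintro ⟨r, hr, _, ⟨y, hy, rfl⟩, rfl⟩
      exact ⟨r, hr, L y, ⟨_, hy, rfl⟩, by simp⟩
    · rintro ⟨r, hr, _, ⟨y, hy, rfl⟩, h⟩
      refine ⟨r, hr, L.symm y, ⟨L.symm.unitSphereMap y, ?_, rfl⟩, ?_⟩
      · have : L.unitSphereMap (L.symm.unitSphereMap y) = y := by
          ext; simp [unitSphereMap]
        simpa [this] using hy
      · apply L.injective
        simpa using h
  rw [this]
  exact L.measurePreserving.measure_preimage_equiv (f := L.toHomeomorph.toMeasurableEquiv) _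
end

theorem integral_dist_uniformSphere_eq {d : ℕ}
    (x y : Metric.sphere (0 : EuclideanSpace ℝ (Fin d)) 1) :
    ∫ z, dist x z ∂uniformSphere d = ∫ z, dist y z ∂uniformSphere d := by
  obtain ⟨L, hL⟩ := exists_linearIsometryEquiv_apply_eq (x := (x : EuclideanSpace ℝ (Fin d)))
    (y := y) (by simp)
  have hLx : L.unitSphereMap x = y := Subtype.ext hL
  have hmp : MeasurePreserving L.unitSphereMap (uniformSphere d) (uniformSphere d) :=
    L.measurePreserving_unitSphereMap.smul_measure _
  rw [← hLx]
  conv_rhs => rw [← hmp.map_eq]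
  rw [integral_map hmp.measurable.aemeasurable
    (by exact (continuous_const.dist continuous_id).aestronglyMeasurable)]
  refine integral_congr_ae (.of_forall fun z ↦ ?_)
  simp only [Subtype.dist_eq, LinearIsometryEquiv.unitSphereMap, L.dist_map]

theorem integral_dist_uniformSphere {d : ℕ} [NeZero d]
    (x : Metric.sphere (0 : EuclideanSpace ℝ (Fin d)) 1) :
    ∫ z, dist x z ∂uniformSphere d = uniformConst d := by
  rw [uniformConst_eq_integral]
  simp_rw [fun y ↦ integral_dist_uniformSphere_eq y x]
  simp

instance (d : ℕ) : CompactSpace (Metric.sphere (0 : EuclideanSpace ℝ (Fin d)) 1) :=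
  isCompact_iff_compactSpace.1 (isCompact_sphere _ _)

theorem uniformConst_nonneg (d : ℕ) : 0 ≤ uniformConst d :=
  integral_nonneg fun _ ↦ integral_nonneg fun _ ↦ dist_nonneg

/-! ### Uniform distribution maximizes the mean distance. -/

/-- Sums of distances between points of the sphere are at most what they are for uniform
distribution, up to an error term. -/
theorem sum_dist_le_uniformConst_add {d : ℕ} [NeZero d] {n : ℕ}
    (u : Fin n → Metric.sphere (0 : EuclideanSpace ℝ (Fin d)) 1) (m : ℕ) (hm : 0 < m) :
    ∑ i, ∑ j, dist (u i) (u j) ≤ (1 + 1 / m) * n ^ 2 * uniformConst d := by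
  rcases Nat.eq_zero_or_pos n with rfl | hn
  · simp
  set c := uniformConst d with hc
  have hn' : (0 : ℝ) < n := by exact_mod_cast hn
  have hm' : (0 : ℝ) < m := by exact_mod_cast hm
  -- Negative type for the points `u i` with weight `1` and `m` auxiliary points with weight `-n /
  -- m`, of total weight zero. The auxiliary points are then averaged as independent uniform points.
  have key : ∀ v : Fin m → Metric.sphere (0 : EuclideanSpace ℝ (Fin d)) 1, ∑ i, ∑ j, dist (u i) (u j) ≤
      2 * (n / m) * ∑ i, ∑ k, dist (u i) (v k)
        - (n / m) ^ 2 * ∑ k, ∑ l, dist (v k) (v l) := by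
    intro v
    have h := sum_mul_mul_dist_nonpos (E := EuclideanSpace ℝ (Fin d)) Finset.univ
      (Sum.elim (fun _ : Fin n ↦ (1 : ℝ)) (fun _ : Fin m ↦ -(n / m : ℝ)))
      (Sum.elim (fun i ↦ (u i : EuclideanSpace ℝ (Fin d))) (fun k ↦ v k))
      (by simp; field_simp; ring)
    simp only [Fintype.sum_sum_type, Sum.elim_inl, Sum.elim_inr] at h
    simp only [Finset.sum_add_distrib, mul_assoc, ← Finset.mul_sum, one_mul] at h
    have hsymm : ∑ k, ∑ i, dist (v k : EuclideanSpace ℝ (Fin d)) (u i)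
        = ∑ i, ∑ k, dist (u i : EuclideanSpace ℝ (Fin d)) (v k) := by
      rw [Finset.sum_comm]; simp_rw [dist_comm]
    rw [hsymm] at h
    simp only [Subtype.dist_eq]
    linarith
  set ν := uniformSphere d
  have hcont : ∀ {f : (Fin m → Metric.sphere (0 : EuclideanSpace ℝ (Fin d)) 1) → ℝ}, Continuous f → Integrable f (Measure.pi fun _ ↦ ν) :=
    fun hf ↦ hf.integrable_of_hasCompactSupport (HasCompactSupport.of_compactSpace _)
  have h1 : ∀ x : Metric.sphere (0 : EuclideanSpace ℝ (Fin d)) 1, ∀ k, ∫ v, dist x (v k) ∂(Measure.pi fun _ : Fin m ↦ ν) = c := by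
    intro x k
    have := (measurePreserving_eval (fun _ : Fin m ↦ ν) k).map_eq
    rw [hc, ← integral_dist_uniformSphere x]
    conv_rhs => rw [show uniformSphere d = ν from rfl, ← this]
    rw [integral_map (measurable_pi_apply k).aemeasurable
      (by exact (continuous_const.dist continuous_id).aestronglyMeasurable)]
  have h2 : ∀ k l, k ≠ l → ∫ v, dist (v k) (v l) ∂(Measure.pi fun _ : Fin m ↦ ν) = c := by
    intro k l hkl
    have hind := (ProbabilityTheory.iIndepFun_pi (μ := fun _ : Fin m ↦ ν)
      (X := fun _ x ↦ x) (fun _ ↦ aemeasurable_id)).indepFun hkl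
    rw [ProbabilityTheory.indepFun_iff_map_prod_eq_prod_map_map
      (measurable_pi_apply k).aemeasurable (measurable_pi_apply l).aemeasurable] at hind
    have hmap : ∀ k, (Measure.pi fun _ : Fin m ↦ ν).map (fun v ↦ v k) = ν := fun k ↦
      (measurePreserving_eval (fun _ : Fin m ↦ ν) k).map_eq
    rw [hmap, hmap] at hind
    have hcd : Continuous fun p : Metric.sphere (0 : EuclideanSpace ℝ (Fin d)) 1 ×
        Metric.sphere (0 : EuclideanSpace ℝ (Fin d)) 1 ↦ dist p.1 p.2 := continuous_dist
    have hprod : ∫ p : Metric.sphere (0 : EuclideanSpace ℝ (Fin d)) 1 ×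
        Metric.sphere (0 : EuclideanSpace ℝ (Fin d)) 1, dist p.1 p.2 ∂(ν.prod ν) = c := by
      rw [integral_prod _ (hcd.integrable_of_hasCompactSupport (HasCompactSupport.of_compactSpace _))]
      exact (uniformConst_eq_integral d).symm
    rw [← hprod, ← hind, integral_map (by fun_prop) hcd.aestronglyMeasurable]
  -- The vanishing diagonal leaves `m * (m - 1)` pairs instead of `m ^ 2`; this is the source of the
  -- error `1 / m`.
  have h3 : ∑ k, ∑ l, ∫ v, dist (v k) (v l) ∂(Measure.pi fun _ : Fin m ↦ ν)
      = m * (m - 1) * c := by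
    have : ∀ k l : Fin m, ∫ v, dist (v k) (v l) ∂(Measure.pi fun _ : Fin m ↦ ν)
        = c - if k = l then c else 0 := by
      intro k l
      split_ifs with h
      · subst h; simp
      · rw [h2 k l h, sub_zero]
    simp_rw [this, Finset.sum_sub_distrib]
    simp
    ring
  have h4 : ∫ v, ∑ i, ∑ k, dist (u i) (v k) ∂(Measure.pi fun _ : Fin m ↦ ν) = n * m * c := by
    rw [integral_finsetSum _ fun i _ ↦ hcont (by fun_prop),
      Finset.sum_congr rfl fun i _ ↦ integral_finsetSum _ fun k _ ↦ hcont (by fun_prop)]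
    simp [h1, mul_assoc]
  have h5 : ∫ v, ∑ k, ∑ l, dist (v k) (v l) ∂(Measure.pi fun _ : Fin m ↦ ν)
      = m * (m - 1) * c := by
    rw [integral_finsetSum _ fun i _ ↦ hcont (by fun_prop),
      Finset.sum_congr rfl fun i _ ↦ integral_finsetSum _ fun k _ ↦ hcont (by fun_prop), h3]
  have hi := integral_mono (μ := Measure.pi fun _ : Fin m ↦ ν) (hcont continuous_const)
    (hcont (by fun_prop)) key
  rw [integral_sub (hcont (by fun_prop)) (hcont (by fun_prop)), integral_const_mul,
    integral_const_mul, h4, h5] at hi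
  simp only [integral_const, probReal_univ, one_smul] at hi
  refine hi.trans (le_of_eq ?_)
  field_simp
  ring

/-- The sum of the distances between points of the sphere is at most what it is for uniform
distribution. -/
theorem sum_dist_le_uniformConst {d : ℕ} [NeZero d] {n : ℕ}
    (u : Fin n → Metric.sphere (0 : EuclideanSpace ℝ (Fin d)) 1) :
    ∑ i, ∑ j, dist (u i) (u j) ≤ n ^ 2 * uniformConst d := by
  have h : Tendsto (fun m : ℕ ↦ (1 + 1 / (m : ℝ)) * n ^ 2 * uniformConst d) atTop
      (𝓝 ((1 + 0) * n ^ 2 * uniformConst d)) :=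
    ((tendsto_one_div_atTop_nhds_zero_nat.const_add 1).mul_const _).mul_const _
  rw [add_zero, one_mul] at h
  exact ge_of_tendsto h ((eventually_gt_atTop 0).mono fun m hm ↦
    sum_dist_le_uniformConst_add u m hm)

/-! ### Extremal configurations on the sphere and the lower bound. -/

theorem sum_sum_eq_add_two_mul_sum_erase {ι : Type*} [Fintype ι] [DecidableEq ι] (f : ι → ι → ℝ)
    (hf : ∀ i j, f i j = f j i) (h0 : ∀ i, f i i = 0) (i : ι) :
    ∑ j, ∑ k, f j k = 2 * ∑ k ∈ Finset.univ.erase i, f i k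
      + ∑ j ∈ Finset.univ.erase i, ∑ k ∈ Finset.univ.erase i, f j k := by
  rw [← Finset.add_sum_erase _ _ (Finset.mem_univ i)]
  simp_rw [← Finset.add_sum_erase _ _ (Finset.mem_univ i), h0, Finset.sum_add_distrib, hf _ i]
  ring

/-- In a compact space there are `n` points such that none of them can be moved away from the
others. -/
theorem exists_forall_sum_dist_le {X : Type*} [PseudoMetricSpace X] [CompactSpace X] [Nonempty X]
    (n : ℕ) : ∃ u : Fin n → X, ∀ i x,
      ∑ j ∈ Finset.univ.erase i, dist x (u j) ≤ ∑ j ∈ Finset.univ.erase i, dist (u i) (u j) := by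
  -- At a maximum of the total distance, replacing one point changes only the terms that involve it.
  obtain ⟨u, -, hu⟩ := isCompact_univ.exists_isMaxOn (univ_nonempty (α := Fin n → X))
    (f := fun u ↦ ∑ i, ∑ j, dist (u i) (u j)) (by fun_prop)
  refine ⟨u, fun i x ↦ ?_⟩
  have h := hu (mem_univ (Function.update u i x))
  simp only [mem_ofPred_eq] at h
  rw [sum_sum_eq_add_two_mul_sum_erase _ (fun _ _ ↦ dist_comm _ _) (fun _ ↦ dist_self _) i,
    sum_sum_eq_add_two_mul_sum_erase (fun j k ↦ dist (u j) (u k)) (fun _ _ ↦ dist_comm _ _)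
      (fun _ ↦ dist_self _) i] at h
  have hne : ∀ j ∈ Finset.univ.erase i, Function.update u i x j = u j := fun j hj ↦
    Function.update_of_ne (Finset.ne_of_mem_erase hj) _ _
  rw [Finset.sum_congr rfl fun j hj ↦ by rw [hne j hj],
    Finset.sum_congr rfl fun j hj ↦ Finset.sum_congr rfl fun k hk ↦ by rw [hne j hj, hne k hk],
    Function.update_self] at h
  linarith

section
variable {E : Type*} [NormedAddCommGroup E] [InnerProductSpace ℝ E]

theorem exists_norm_eq_one_inner_eq_zero [FiniteDimensional ℝ E] (h : 2 ≤ Module.finrank ℝ E)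
    (p : E) : ∃ v : E, ‖v‖ = 1 ∧ inner ℝ p v = 0 := by
  have h1 : Module.finrank ℝ (ℝ ∙ p) ≤ 1 := by
    simpa using finrank_span_le_card (R := ℝ) ({p} : Set E)
  have h2 := Submodule.finrank_add_finrank_orthogonal (ℝ ∙ p)
  have : Nontrivial (ℝ ∙ p)ᗮ := Module.nontrivial_of_finrank_pos (R := ℝ) (by omega)
  obtain ⟨v, hv⟩ := exists_norm_eq (ℝ ∙ p)ᗮ zero_le_one
  exact ⟨v, hv, Submodule.mem_orthogonal_singleton_iff_inner_right.1 v.2⟩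

/-- Two opposite points at distance `2 * s` from `p` on a great circle through `p`. -/
theorem exists_opposite_points [FiniteDimensional ℝ E] (h : 2 ≤ Module.finrank ℝ E) {p : E}
    (hp : ‖p‖ = 1) {s : ℝ} (hs : 0 ≤ s) (hs1 : s ≤ 1) :
    ∃ x y : E, ‖x‖ = 1 ∧ ‖y‖ = 1 ∧ dist x p = 2 * s ∧ dist y p = 2 * s ∧
      ∀ q : E, 2 * dist p q - 4 * s ^ 2 ≤ dist x q + dist y q := by
  obtain ⟨v, hv, hpv⟩ := exists_norm_eq_one_inner_eq_zero h p
  set α := 1 - 2 * s ^ 2 with hα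
  set β := √(1 - α ^ 2)
  have hβ : β ^ 2 = 1 - α ^ 2 := Real.sq_sqrt (by
    have : 0 ≤ s ^ 2 * (1 - s ^ 2) := mul_nonneg (sq_nonneg s) (by nlinarith)
    nlinarith)
  have hnorm : ∀ a b : ℝ, ‖a • p + b • v‖ ^ 2 = a ^ 2 + b ^ 2 := by
    intro a b
    rw [norm_add_sq_real, inner_smul_left, inner_smul_right, hpv, norm_smul, norm_smul, hp, hv]
    simp
  have hone : ∀ b : ℝ, b ^ 2 = β ^ 2 → ‖α • p + b • v‖ = 1 := by
    intro b hb
    have := hnorm α b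
    rw [hb, hβ] at this
    exact (sq_eq_sq₀ (norm_nonneg _) zero_le_one).1 (by linarith)
  have hdist : ∀ b : ℝ, b ^ 2 = β ^ 2 → dist (α • p + b • v) p = 2 * s := by
    intro b hb
    rw [dist_eq_norm, show α • p + b • v - p = (α - 1) • p + b • v by module]
    have := hnorm (α - 1) b
    rw [hb, hβ] at this
    refine (sq_eq_sq₀ (norm_nonneg _) (by positivity)).1 ?_
    rw [this, hα]; ring
  refine ⟨α • p + β • v, α • p + (-β) • v, hone _ rfl, hone _ (neg_sq _), hdist _ rfl,
    hdist _ (neg_sq _), fun q ↦ ?_⟩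
  -- The midpoint of the two points is `α • p`, which lies within `2 * s ^ 2` of `p`: the loss is of
  -- second order in `s`.
  have h1 : ‖(2 : ℝ) • (α • p - q)‖
      ≤ dist (α • p + β • v) q + dist (α • p + (-β) • v) q := by
    rw [dist_eq_norm, dist_eq_norm]
    refine le_trans (le_of_eq ?_) (norm_add_le _ _)
    congr 1; module
  have h2 : dist p q ≤ ‖α • p - q‖ + 2 * s ^ 2 := by
    rw [dist_eq_norm, show p - q = (α • p - q) + (2 * s ^ 2) • p by rw [hα]; module]
    refine (norm_add_le _ _).trans ?_
    rw [norm_smul ((2 : ℝ) * s ^ 2), hp, Real.norm_of_nonneg (by positivity), mul_one]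
  rw [norm_smul, Real.norm_of_nonneg zero_le_two] at h1
  linarith
end

/-- Coincident points would collapse in a `Finset`. If two coincide, moving one of them a little to
either side gains a first-order amount from the other, against a second-order average loss from the
rest. -/
theorem injective_of_forall_sum_dist_le {d : ℕ} (hd : 2 ≤ d) {n : ℕ}
    {u : Fin n → Metric.sphere (0 : EuclideanSpace ℝ (Fin d)) 1}
    (hu : ∀ i x,
      ∑ j ∈ Finset.univ.erase i, dist x (u j) ≤ ∑ j ∈ Finset.univ.erase i, dist (u i) (u j)) :
    Function.Injective u := by
  intro i k hik
  by_contra hne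
  have hn : (1 : ℝ) ≤ n := by exact_mod_cast Fin.pos i
  have hn0 : (0 : ℝ) < n := by linarith
  -- With `s = 1 / n` the two moves together gain `4 * s` and lose at most `(n - 1) * 4 * s ^ 2`,
  -- which is smaller.
  obtain ⟨x, y, hx, hy, hxp, hyp, hxy⟩ := exists_opposite_points
    (E := EuclideanSpace ℝ (Fin d)) (by simpa using hd) (p := u i) (by simp) (s := 1 / n)
    (by positivity) ((div_le_one hn0).2 hn)
  have h1 := hu i ⟨x, by simpa using hx⟩
  have h2 := hu i ⟨y, by simpa using hy⟩
  have hk : k ∈ Finset.univ.erase i := Finset.mem_erase.2 ⟨Ne.symm hne, Finset.mem_univ _⟩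
  rw [← Finset.add_sum_erase _ _ hk, ← Finset.add_sum_erase _ _ hk, ← hik, dist_self] at h1 h2
  simp only [Subtype.dist_eq, hxp, hyp] at h1 h2
  have h3 := Finset.sum_le_sum fun j (_ : j ∈ (Finset.univ.erase i).erase k) ↦ hxy (u j)
  have hcard : (((Finset.univ.erase i).erase k).card : ℝ) ≤ n - 1 := by
    have := Finset.card_erase_of_mem hk
    have h' := Finset.card_erase_of_mem (Finset.mem_univ i)
    rw [Finset.card_univ, Fintype.card_fin] at h'
    have hle : ((Finset.univ.erase i).erase k).card + 1 ≤ n := by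
      have := Fin.pos i
      omega
    have : ((((Finset.univ.erase i).erase k).card + 1 : ℕ) : ℝ) ≤ n := by exact_mod_cast hle
    push_cast at this
    linarith
  rw [Finset.sum_sub_distrib, Finset.sum_add_distrib, ← Finset.mul_sum, Finset.sum_const,
    nsmul_eq_mul] at h3
  have h4 : (((Finset.univ.erase i).erase k).card : ℝ) * (4 * (1 / n) ^ 2)
      ≤ (n - 1) * (4 * (1 / n) ^ 2) := by gcongr
  have h5 : (n - 1) * (4 * (1 / (n : ℝ)) ^ 2) = 4 * (1 / n) - 4 * (1 / n) ^ 2 := by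
    field_simp
  have : 0 < 1 / (n : ℝ) := by positivity
  nlinarith

theorem starLength_nonneg {d : ℕ} (P : Finset (EuclideanSpace ℝ (Fin d)))
    (x : EuclideanSpace ℝ (Fin d)) : 0 ≤ starLength P x :=
  Finset.sum_nonneg fun _ _ ↦ dist_nonneg

theorem bddBelow_range_starLength {d : ℕ} (P : Finset (EuclideanSpace ℝ (Fin d))) :
    BddBelow (range (starLength P)) :=
  ⟨0, by rintro _ ⟨x, rfl⟩; exact starLength_nonneg P x⟩

theorem minSteinerStar_pos {d : ℕ} {P : Finset (EuclideanSpace ℝ (Fin d))} (hP : 2 ≤ P.card) :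
    0 < minSteinerStar P := by
  obtain ⟨p, hp, q, hq, hpq⟩ := Finset.one_lt_card.1 hP
  refine (dist_pos.2 hpq).trans_le (le_ciInf fun x ↦ ?_)
  have : ∑ r ∈ {p, q}, dist x r ≤ starLength P x :=
    Finset.sum_le_sum_of_subset_of_nonneg (by simp [Finset.insert_subset_iff, hp, hq])
      fun _ _ _ ↦ dist_nonneg
  rw [Finset.sum_pair hpq] at this
  linarith [dist_triangle_left p q x]

theorem exists_mem_starRatios_ge {d : ℕ} (hd : 2 ≤ d) {n : ℕ} (hn : 2 ≤ n) :
    ∃ r ∈ starRatios d, (1 - 1 / (n : ℝ)) * uniformConst d ≤ r := by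
  have : NeZero d := ⟨by omega⟩
  have hn0 : (0 : ℝ) < n := by positivity
  have : Nonempty (Metric.sphere (0 : EuclideanSpace ℝ (Fin d)) 1) :=
    (NormedSpace.sphere_nonempty.2 zero_le_one).to_subtype
  obtain ⟨u, hu⟩ := exists_forall_sum_dist_le
    (X := Metric.sphere (0 : EuclideanSpace ℝ (Fin d)) 1) n
  have hinj : Function.Injective fun i ↦ (u i : EuclideanSpace ℝ (Fin d)) :=
    Subtype.val_injective.comp (injective_of_forall_sum_dist_le hd hu)
  set P : Finset (EuclideanSpace ℝ (Fin d)) := Finset.univ.map ⟨_, hinj⟩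
  have hcard : P.card = n := by simp [P]
  have hPne : P.Nonempty := Finset.card_pos.1 (by omega)
  refine ⟨_, ⟨P, hPne, by omega, rfl⟩, ?_⟩
  have hlen : ∀ x, starLength P x = ∑ i, dist x (u i : EuclideanSpace ℝ (Fin d)) := by
    intro x; simp [starLength, P]
  have hpos := minSteinerStar_pos (P := P) (by omega)
  have hle : minSteinerStar P ≤ n := by
    refine (ciInf_le (bddBelow_range_starLength P) 0).trans (le_of_eq ?_)
    simp [hlen]
  have hmin : (n - 1) * uniformConst d ≤ minStar P hPne := by
    refine Finset.le_inf' _ _ fun p hp ↦ ?_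
    obtain ⟨i, -, rfl⟩ := Finset.mem_map.1 hp
    simp only [Function.Embedding.coeFn_mk, hlen]
    have hcont : ∀ {f : Metric.sphere (0 : EuclideanSpace ℝ (Fin d)) 1 → ℝ}, Continuous f →
        Integrable f (uniformSphere d) :=
      fun hf ↦ hf.integrable_of_hasCompactSupport (HasCompactSupport.of_compactSpace _)
    -- Extremality of `u i` is averaged over all competing positions.
    have h := integral_mono (μ := uniformSphere d) (hcont (by fun_prop))
      (hcont continuous_const) (hu i)
    rw [integral_finsetSum _ fun j _ ↦ hcont (by fun_prop)] at h
    have hc : ∀ j, ∫ x, dist x (u j) ∂uniformSphere d = uniformConst d := fun j ↦ by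
      simp_rw [dist_comm _ (u j)]
      exact integral_dist_uniformSphere (u j)
    simp only [hc] at h
    simp only [Finset.sum_const, Finset.card_erase_of_mem (Finset.mem_univ i), Finset.card_univ,
      Fintype.card_fin, nsmul_eq_mul, integral_const, probReal_univ, one_smul] at h
    rw [Nat.cast_sub (by omega), Nat.cast_one] at h
    rw [← Finset.add_sum_erase _ _ (Finset.mem_univ i), dist_self, zero_add]
    simpa only [Subtype.dist_eq] using h
  rw [le_div_iff₀ hpos]
  have hn1 : (1 : ℝ) ≤ n := by exact_mod_cast (by omega : 1 ≤ n)
  calc (1 - 1 / (n : ℝ)) * uniformConst d * minSteinerStar P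
      ≤ (1 - 1 / (n : ℝ)) * uniformConst d * n := by
        refine mul_le_mul_of_nonneg_left hle (mul_nonneg ?_ (uniformConst_nonneg d))
        rw [sub_nonneg]; exact (div_le_one hn0).2 hn1
    _ = (n - 1) * uniformConst d := by field_simp
    _ ≤ _ := hmin

/-! ### Polar coordinates and the law of a coordinate on the sphere. -/

open scoped ENNReal in
/-- Integration in polar coordinates. -/
theorem lintegral_eq_lintegral_toSphere {E : Type*} [NormedAddCommGroup E] [NormedSpace ℝ E]
    [FiniteDimensional ℝ E] [Nontrivial E] [MeasurableSpace E] [BorelSpace E] (μ : Measure E)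
    [μ.IsAddHaarMeasure] {F : E → ℝ≥0∞} (hF : Measurable F) :
    ∫⁻ x, F x ∂μ = ∫⁻ r in Ioi (0 : ℝ), ENNReal.ofReal (r ^ (Module.finrank ℝ E - 1)) *
      ∫⁻ y, F (r • (y : E)) ∂μ.toSphere := by
  have hG : Measurable fun p : Metric.sphere (0 : E) 1 × Ioi (0 : ℝ) ↦
      F ((p.2 : ℝ) • (p.1 : E)) := hF.comp (by fun_prop)
  have hG' : Measurable fun r : Ioi (0 : ℝ) ↦ ∫⁻ y, F ((r : ℝ) • (y : E)) ∂μ.toSphere :=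
    hG.lintegral_prod_left'
  calc ∫⁻ x, F x ∂μ = ∫⁻ x : ({(0)}ᶜ : Set E), F x.1 ∂(μ.comap (↑)) := by
        rw [lintegral_subtype_comap (measurableSet_singleton _).compl, restrict_compl_singleton]
    _ = ∫⁻ p, F ((p.2 : ℝ) • (p.1 : E))
          ∂μ.toSphere.prod (.volumeIoiPow (Module.finrank ℝ E - 1)) := by
        rw [← μ.measurePreserving_homeomorphUnitSphereProd.lintegral_comp hG]
        refine lintegral_congr fun x ↦ ?_
        congr 1
        have := (homeomorphUnitSphereProd E).symm_apply_apply x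
        exact (Subtype.ext_iff.1 this).symm
    _ = ∫⁻ r, ∫⁻ y, F ((r : ℝ) • (y : E)) ∂μ.toSphere
          ∂(.volumeIoiPow (Module.finrank ℝ E - 1)) := lintegral_prod_symm' _ hG
    _ = _ := by
        rw [Measure.volumeIoiPow, lintegral_withDensity_eq_lintegral_mul _ (by fun_prop) hG']
        exact lintegral_subtype_comap measurableSet_Ioi fun r ↦
          ENNReal.ofReal (r ^ (Module.finrank ℝ E - 1)) * ∫⁻ y, F (r • (y : E)) ∂μ.toSphere

open scoped ENNReal in
theorem lintegral_comp_norm {E : Type*} [NormedAddCommGroup E] [NormedSpace ℝ E]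
    [FiniteDimensional ℝ E] [Nontrivial E] [MeasurableSpace E] [BorelSpace E] (μ : Measure E)
    [μ.IsAddHaarMeasure] {f : ℝ → ℝ≥0∞} (hf : Measurable f) :
    ∫⁻ x, f ‖x‖ ∂μ = μ.toSphere univ *
      ∫⁻ r in Ioi (0 : ℝ), ENNReal.ofReal (r ^ (Module.finrank ℝ E - 1)) * f r := by
  rw [lintegral_eq_lintegral_toSphere μ (F := fun x ↦ f ‖x‖) (hf.comp measurable_norm),
    ← lintegral_const_mul _ (by fun_prop)]
  refine setLIntegral_congr_fun measurableSet_Ioi fun r hr ↦ ?_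
  have : ∀ y : Metric.sphere (0 : E) 1, ‖r • (y : E)‖ = r := fun y ↦ by
    rw [norm_smul, norm_eq_of_mem_sphere, mul_one, Real.norm_of_nonneg (mem_Ioi.1 hr).le]
  simp only [this, lintegral_const]
  ring

open scoped ENNReal in
theorem EuclideanSpace.lintegral_succ {n : ℕ} {f : ℝ → ℝ → ℝ≥0∞}
    (hf : Measurable (Function.uncurry f)) :
    ∫⁻ x : EuclideanSpace ℝ (Fin (n + 1)), f (x 0) ‖x‖ =
      ∫⁻ t : ℝ, ∫⁻ z : EuclideanSpace ℝ (Fin n), f t √(t ^ 2 + ‖z‖ ^ 2) := by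
  have h1 := PiLp.volume_preserving_ofLp (Fin (n + 1))
  have h2 := volume_preserving_piFinSuccAbove (fun _ : Fin (n + 1) ↦ ℝ) 0
  have h3 := (MeasurePreserving.id (volume : Measure ℝ)).prod (PiLp.volume_preserving_toLp (Fin n))
  have h := (h3.comp h2).comp h1
  have hm : Measurable fun p : ℝ × EuclideanSpace ℝ (Fin n) ↦ f p.1 √(p.1 ^ 2 + ‖p.2‖ ^ 2) :=
    hf.comp (f := fun p : ℝ × EuclideanSpace ℝ (Fin n) ↦ (p.1, √(p.1 ^ 2 + ‖p.2‖ ^ 2)))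
      (by fun_prop)
  rw [← lintegral_prod _ hm.aemeasurable]
  refine Eq.trans ?_ (h.lintegral_comp hm)
  refine lintegral_congr fun x ↦ ?_
  congr 1
  rw [EuclideanSpace.norm_eq, EuclideanSpace.norm_sq_eq, Fin.sum_univ_succ]
  simp [MeasurableEquiv.piFinSuccAbove, Fin.insertNthEquiv, Fin.tail]

open scoped ENNReal in
/-- The distribution of a coordinate on the unit sphere. -/
theorem lintegral_sphereMeasure_comp_coord (m : ℕ) {φ : ℝ → ℝ≥0∞} (hφ : Measurable φ) :
    ∫⁻ y, φ ((y : EuclideanSpace ℝ (Fin (m + 2))) 0) ∂sphereMeasure (m + 2) =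
      sphereMeasure (m + 1) univ *
        ∫⁻ θ in Ioo 0 π, ENNReal.ofReal (sin θ ^ m) * φ (cos θ) := by
  -- The cutoff to the unit ball makes the radial factor `K` finite and nonzero, so that it can be
  -- cancelled after the integral over the ball is computed in two ways.
  set χ : ℝ → ℝ≥0∞ := (Iio 1).indicator 1 with hχ
  have hχm : Measurable χ := measurable_one.indicator measurableSet_Iio
  set K : ℝ≥0∞ := ∫⁻ r in Ioi (0 : ℝ), ENNReal.ofReal (r ^ (m + 1)) * χ r with hK
  have hKeq : K = ∫⁻ r in Ioo (0 : ℝ) 1, ENNReal.ofReal (r ^ (m + 1)) := by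
    rw [hK, ← lintegral_indicator measurableSet_Ioi, ← lintegral_indicator measurableSet_Ioo]
    refine lintegral_congr fun r ↦ ?_
    by_cases h0 : 0 < r <;> by_cases h1 : r < 1 <;> simp [hχ, indicator, h0, h1]
  have hK0 : K ≠ 0 := by
    rw [hKeq, ← pos_iff_ne_zero, setLIntegral_pos_iff (by fun_prop)]
    have : Ioo (0 : ℝ) 1 ⊆ Function.support fun r : ℝ ↦ ENNReal.ofReal (r ^ (m + 1)) :=
      fun r hr ↦ by simpa using pow_pos hr.1 _
    rw [inter_eq_right.2 this]
    simp
  have hKt : K ≠ ∞ := by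
    rw [hKeq]
    refine ne_top_of_le_ne_top ENNReal.one_ne_top
      ((setLIntegral_mono measurable_one fun r hr ↦ ?_).trans_eq (by simp))
    exact ENNReal.ofReal_le_one.2 (pow_le_one₀ hr.1.le hr.2.le)
  have hf : Measurable (Function.uncurry fun t r : ℝ ↦ φ (t / r) * χ r) := by
    unfold Function.uncurry; fun_prop
  have hA : ∫⁻ x : EuclideanSpace ℝ (Fin (m + 2)), φ (x 0 / ‖x‖) * χ ‖x‖
      = K * ∫⁻ y, φ ((y : EuclideanSpace ℝ (Fin (m + 2))) 0) ∂sphereMeasure (m + 2) := by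
    rw [lintegral_eq_lintegral_toSphere volume (F := fun x : EuclideanSpace ℝ (Fin (m + 2)) ↦
      φ (x 0 / ‖x‖) * χ ‖x‖) (by fun_prop), hK, ← lintegral_mul_const _ (by fun_prop)]
    refine setLIntegral_congr_fun measurableSet_Ioi fun r hr ↦ ?_
    have hr0 : 0 < r := hr
    have : ∀ y : Metric.sphere (0 : EuclideanSpace ℝ (Fin (m + 2))) 1,
        ‖r • (y : EuclideanSpace ℝ (Fin (m + 2)))‖ = r := fun y ↦ by
      rw [norm_smul, norm_eq_of_mem_sphere, mul_one, Real.norm_of_nonneg hr0.le]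
    simp only [this, PiLp.smul_apply, smul_eq_mul, mul_div_cancel_left₀ _ hr0.ne']
    rw [lintegral_mul_const _ (by fun_prop)]
    simp only [finrank_euclideanSpace, Fintype.card_fin,
      show m + 2 - 1 = m + 1 from rfl, sphereMeasure]
    ring
  -- Slicing by the first coordinate leaves a radial integrand in the other `m + 1` coordinates,
  -- hence an integral over a half-plane with weight `ρ ^ m`.
  have hB : ∫⁻ x : EuclideanSpace ℝ (Fin (m + 2)), φ (x 0 / ‖x‖) * χ ‖x‖
      = sphereMeasure (m + 1) univ * ∫⁻ p : ℝ × ℝ, (Ioi 0).indicator 1 p.2 *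
        (ENNReal.ofReal (p.2 ^ m) * (φ (p.1 / √(p.1 ^ 2 + p.2 ^ 2)) * χ √(p.1 ^ 2 + p.2 ^ 2))) := by
    have hind : Measurable ((Ioi (0 : ℝ)).indicator (1 : ℝ → ℝ≥0∞)) :=
      measurable_one.indicator measurableSet_Ioi
    rw [EuclideanSpace.lintegral_succ hf, Measure.volume_eq_prod,
      lintegral_prod _ (by fun_prop), ← lintegral_const_mul]
    · refine lintegral_congr fun t ↦ ?_
      rw [lintegral_comp_norm volume (f := fun ρ ↦ φ (t / √(t ^ 2 + ρ ^ 2)) * χ √(t ^ 2 + ρ ^ 2))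
        (by fun_prop), ← lintegral_indicator measurableSet_Ioi]
      congr 1
      refine lintegral_congr fun ρ ↦ ?_
      simp only [finrank_euclideanSpace, Fintype.card_fin, Nat.add_sub_cancel, indicator]
      split_ifs <;> simp
    · exact Measurable.lintegral_prod_right (by fun_prop)
  -- In planar polar coordinates the weight and the Jacobian give `r ^ (m + 1) * sin θ ^ m`, which
  -- separates.
  have hC : ∫⁻ p : ℝ × ℝ, (Ioi 0).indicator 1 p.2 *
        (ENNReal.ofReal (p.2 ^ m) * (φ (p.1 / √(p.1 ^ 2 + p.2 ^ 2)) * χ √(p.1 ^ 2 + p.2 ^ 2)))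
      = K * ∫⁻ θ in Ioo 0 π, ENNReal.ofReal (sin θ ^ m) * φ (cos θ) := by
    have hsplit : ∫⁻ θ in Ioo 0 π, ENNReal.ofReal (sin θ ^ m) * φ (cos θ)
        = ∫⁻ θ in Ioo (-π) π, (Ioi 0).indicator 1 θ *
          (ENNReal.ofReal (sin θ ^ m) * φ (cos θ)) := by
      rw [← lintegral_indicator measurableSet_Ioo, ← lintegral_indicator measurableSet_Ioo]
      refine lintegral_congr fun θ ↦ ?_
      simp only [indicator, mem_Ioo, mem_Ioi, Pi.one_apply]
      by_cases h0 : 0 < θ <;> by_cases h1 : θ < π <;> simp [h0, h1]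
      intro h; linarith [pi_pos]
    have hind : Measurable ((Ioi (0 : ℝ)).indicator (1 : ℝ → ℝ≥0∞)) :=
      measurable_one.indicator measurableSet_Ioi
    rw [← lintegral_comp_polarCoord_symm, hsplit, hK, ← lintegral_prod_mul (by fun_prop)
      (by fun_prop), Measure.prod_restrict, ← Measure.volume_eq_prod, polarCoord_target]
    refine setLIntegral_congr_fun (measurableSet_Ioi.prod measurableSet_Ioo) ?_
    rintro ⟨r, θ⟩ ⟨hr, hθ⟩
    have hr0 : 0 < r := hr
    have hsq : √((r * cos θ) ^ 2 + (r * sin θ) ^ 2) = r := by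
      rw [show (r * cos θ) ^ 2 + (r * sin θ) ^ 2 = r ^ 2 * (sin θ ^ 2 + cos θ ^ 2) by ring,
        sin_sq_add_cos_sq, mul_one, sqrt_sq hr0.le]
    simp only [polarCoord_symm_apply, hsq, mul_div_cancel_left₀ _ hr0.ne', smul_eq_mul]
    by_cases h0 : 0 < θ
    · have hs : 0 < sin θ := sin_pos_of_pos_of_lt_pi h0 hθ.2
      have : 0 < r * sin θ := mul_pos hr0 hs
      simp only [indicator, mem_Ioi, this, h0, if_true, Pi.one_apply, one_mul]
      rw [mul_pow, ENNReal.ofReal_mul (by positivity), pow_succ, ENNReal.ofReal_mul (by positivity)]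
      ring
    · have hs : sin θ ≤ 0 := sin_nonpos_of_nonpos_of_neg_pi_le (not_lt.1 h0) hθ.1.le
      have : ¬ 0 < r * sin θ := not_lt.2 (mul_nonpos_of_nonneg_of_nonpos hr0.le hs)
      simp [indicator, this, h0]
  rw [hB, hC, mul_left_comm] at hA
  exact ((ENNReal.mul_right_inj hK0 hKt).1 hA).symm

theorem integral_sphereMeasure_comp_coord (m : ℕ) {φ : ℝ → ℝ} (hφ : Continuous φ)
    (h0 : ∀ t, 0 ≤ φ t) :
    ∫ y, φ ((y : EuclideanSpace ℝ (Fin (m + 2))) 0) ∂sphereMeasure (m + 2) =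
      (sphereMeasure (m + 1)).real univ * ∫ θ in 0..π, sin θ ^ m * φ (cos θ) := by
  rw [intervalIntegral.integral_of_le pi_pos.le, ← integral_Ioc_eq_integral_Ioo.symm,
    integral_eq_lintegral_of_nonneg_ae (.of_forall fun _ ↦ h0 _)
      (by fun_prop),
    integral_eq_lintegral_of_nonneg_ae _ (by fun_prop),
    lintegral_sphereMeasure_comp_coord m (φ := fun t ↦ ENNReal.ofReal (φ t)) (by fun_prop),
    ENNReal.toReal_mul, Measure.real]
  · congr 2
    refine setLIntegral_congr_fun measurableSet_Ioo fun θ hθ ↦ ?_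
    rw [ENNReal.ofReal_mul (pow_nonneg (sin_pos_of_mem_Ioo hθ).le _)]
  · filter_upwards [ae_restrict_mem measurableSet_Ioo] with θ hθ
    exact mul_nonneg (pow_nonneg (sin_pos_of_mem_Ioo hθ).le _) (h0 _)

/-- The constant of uniform distribution as a quotient of integrals over an interval. -/
theorem uniformConst_add_two (m : ℕ) :
    uniformConst (m + 2) =
      (∫ θ in 0..π, sin θ ^ m * √(2 - 2 * cos θ)) / ∫ θ in 0..π, sin θ ^ m := by
  set e : Metric.sphere (0 : EuclideanSpace ℝ (Fin (m + 2))) 1 :=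
    ⟨EuclideanSpace.single 0 1, by simp⟩
  have hdist : ∀ z, dist e z = √(2 - 2 * (z : EuclideanSpace ℝ (Fin (m + 2))) 0) := by
    intro z
    rw [Subtype.dist_eq, dist_eq_norm, ← sqrt_sq (norm_nonneg _), norm_sub_sq_real]
    congr 1
    simp only [e, EuclideanSpace.inner_single_left, norm_eq_of_mem_sphere]
    simp
    ring
  have hC : (sphereMeasure (m + 1)).real univ ≠ 0 := by
    simp [measureReal_eq_zero_iff]
    exact NeZero.ne (sphereMeasure (m + 1))
  have h1 := integral_sphereMeasure_comp_coord m (φ := fun t ↦ √(2 - 2 * t)) (by fun_prop)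
    (fun _ ↦ sqrt_nonneg _)
  have h2 := integral_sphereMeasure_comp_coord m (φ := fun _ ↦ 1) continuous_const
    (fun _ ↦ zero_le_one)
  simp only [integral_const, smul_eq_mul, mul_one] at h2
  rw [← integral_dist_uniformSphere e]
  simp_rw [hdist]
  rw [uniformSphere, integral_smul_measure, h1, ENNReal.toReal_inv, ← Measure.real, h2,
    smul_eq_mul]
  field_simp

/-! ### Recursion, bounds and limit for the constant of uniform distribution. -/

theorem sqrt_two_sub_two_mul_cos {θ : ℝ} (h0 : 0 ≤ θ) (h1 : θ ≤ π) :
    √(2 - 2 * cos θ) = 2 * sin (θ / 2) := by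
  have hs : 0 ≤ sin (θ / 2) := sin_nonneg_of_nonneg_of_le_pi (by linarith) (by linarith)
  have hc : cos θ = 1 - 2 * sin (θ / 2) ^ 2 := by
    rw [← cos_two_mul_eq_one_sub, mul_div_cancel₀ _ two_ne_zero]
  rw [hc, ← sqrt_sq (mul_nonneg zero_le_two hs)]
  congr 1; ring

theorem integral_sin_half_mul_sin_pow_add_two (m : ℕ) :
    ((m + 2 : ℝ) ^ 2 - 1 / 4) * ∫ θ in 0..π, sin (θ / 2) * sin θ ^ (m + 2) =
      (m + 2) * (m + 1) * ∫ θ in 0..π, sin (θ / 2) * sin θ ^ m := by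
  -- The antiderivative is the Wronskian `f * g' - f' * g` of `f = sin (θ / 2)` and `g = sin θ ^ (m
  -- + 2)`. Since `f'' = -f / 4`, its derivative is `f * (g'' + g / 4)`; it vanishes at both ends.
  have hderiv : ∀ θ : ℝ, HasDerivAt
      (fun θ ↦ sin (θ / 2) * ((m + 2) * (sin θ ^ (m + 1) * cos θ))
        - 1 / 2 * (cos (θ / 2) * sin θ ^ (m + 2)))
      ((m + 2) * (m + 1) * (sin (θ / 2) * sin θ ^ m)
        - ((m + 2 : ℝ) ^ 2 - 1 / 4) * (sin (θ / 2) * sin θ ^ (m + 2))) θ := by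
    intro θ
    have hh : HasDerivAt (fun θ : ℝ ↦ θ / 2) (1 / 2) θ := (hasDerivAt_id θ).div_const 2
    have hs := hh.sin
    have hc := hh.cos
    have h1 := (hasDerivAt_sin θ).pow (m + 1)
    have h2 := (hasDerivAt_sin θ).pow (m + 2)
    have h := (hs.mul ((h1.mul (hasDerivAt_cos θ)).const_mul (m + 2 : ℝ))).sub
      ((hc.mul h2).const_mul (1 / 2 : ℝ))
    refine h.congr_deriv ?_
    have hcos : cos θ ^ 2 = 1 - sin θ ^ 2 := by rw [← sin_sq_add_cos_sq θ]; ring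
    simp only [Nat.add_sub_cancel, show m + 2 - 1 = m + 1 from rfl, Pi.mul_apply, Pi.pow_apply]
    push_cast
    linear_combination (sin (θ / 2) * (m + 2) * (m + 1) * sin θ ^ m) * hcos
  have h := intervalIntegral.integral_eq_sub_of_hasDerivAt (a := 0) (b := π)
    (fun θ _ ↦ hderiv θ) (Continuous.intervalIntegrable (by fun_prop) _ _)
  rw [intervalIntegral.integral_sub (Continuous.intervalIntegrable (by fun_prop) _ _)
    (Continuous.intervalIntegrable (by fun_prop) _ _), intervalIntegral.integral_const_mul,
    intervalIntegral.integral_const_mul] at h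
  simp at h
  linarith

theorem uniformConst_recursion {d : ℕ} (hd : 2 ≤ d) :
    uniformConst (d + 2) = 4 * (d : ℝ) ^ 2 / (4 * (d : ℝ) ^ 2 - 1) * uniformConst d := by
  obtain ⟨m, rfl⟩ := Nat.exists_eq_add_of_le' hd
  have hJ : ∀ m : ℕ, ∫ θ in 0..π, sin θ ^ m * √(2 - 2 * cos θ)
      = 2 * ∫ θ in 0..π, sin (θ / 2) * sin θ ^ m := by
    intro m
    rw [← intervalIntegral.integral_const_mul]
    refine intervalIntegral.integral_congr fun θ hθ ↦ ?_
    rw [uIcc_of_le pi_pos.le] at hθ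
    simp only [sqrt_two_sub_two_mul_cos hθ.1 hθ.2]
    ring
  rw [uniformConst_add_two, uniformConst_add_two, hJ, hJ, integral_sin_pow]
  have h := integral_sin_half_mul_sin_pow_add_two m
  have hD := integral_sin_pow_pos m
  set A := ∫ θ in 0..π, sin (θ / 2) * sin θ ^ m
  set B := ∫ θ in 0..π, sin (θ / 2) * sin θ ^ (m + 2)
  set D := ∫ θ in 0..π, sin θ ^ m
  have hm : (0 : ℝ) ≤ m := m.cast_nonneg
  have hne : 4 * (m + 2 : ℝ) ^ 2 - 1 ≠ 0 := by nlinarith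
  have hB : B = 4 * ((m + 2) * (m + 1)) / (4 * (m + 2 : ℝ) ^ 2 - 1) * A := by
    field_simp
    linarith
  rw [hB]
  simp
  field_simp

/-- The tangent bound `√(1 - t) ≤ 1 - t / 2` at `t = cos θ` suffices, as the linear term integrates
to zero. -/
theorem uniformConst_le_sqrt_two {d : ℕ} (hd : 2 ≤ d) : uniformConst d ≤ √2 := by
  obtain ⟨m, rfl⟩ := Nat.exists_eq_add_of_le' hd
  rw [uniformConst_add_two, div_le_iff₀ (integral_sin_pow_pos m)]
  have h0 : ∫ θ in 0..π, sin θ ^ m * cos θ = 0 := by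
    simpa using integral_sin_pow_mul_cos_pow_odd (a := 0) (b := π) m 0
  calc ∫ θ in 0..π, sin θ ^ m * √(2 - 2 * cos θ)
      ≤ ∫ θ in 0..π, (√2 * sin θ ^ m - √2 / 2 * (sin θ ^ m * cos θ)) := by
        refine intervalIntegral.integral_mono_on pi_pos.le
          (Continuous.intervalIntegrable (by fun_prop) _ _)
          (Continuous.intervalIntegrable (by fun_prop) _ _) fun θ hθ ↦ ?_
        have hs : 0 ≤ sin θ ^ m := pow_nonneg (sin_nonneg_of_mem_Icc hθ) m
        have : √(2 - 2 * cos θ) ≤ √2 * (1 - cos θ / 2) := by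
          have hc := cos_le_one θ
          rw [show 2 - 2 * cos θ = 2 * (1 - cos θ) by ring, sqrt_mul zero_le_two]
          refine mul_le_mul_of_nonneg_left ?_ (sqrt_nonneg _)
          rw [sqrt_le_left (by linarith)]
          nlinarith [sq_nonneg (cos θ)]
        calc _ ≤ sin θ ^ m * (√2 * (1 - cos θ / 2)) := mul_le_mul_of_nonneg_left this hs
          _ = _ := by ring
    _ = √2 * ∫ θ in 0..π, sin θ ^ m := by
        rw [intervalIntegral.integral_sub (Continuous.intervalIntegrable (by fun_prop) _ _)
          (Continuous.intervalIntegrable (by fun_prop) _ _), intervalIntegral.integral_const_mul,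
          intervalIntegral.integral_const_mul, h0, mul_zero, sub_zero]

/-- On `[-1, 1]`, `√(1 - t) ≥ 1 - t / 2 - t ^ 2 / 2`. The linear term integrates to zero, and the
mean of `cos θ ^ 2` for the weight `sin θ ^ m` is `1 / d`, where `d = m + 2`. -/
theorem sqrt_two_mul_le_uniformConst {d : ℕ} (hd : 2 ≤ d) :
    √2 * (1 - 1 / (2 * d)) ≤ uniformConst d := by
  obtain ⟨m, rfl⟩ := Nat.exists_eq_add_of_le' hd
  rw [uniformConst_add_two, le_div_iff₀ (integral_sin_pow_pos m)]
  have h0 : ∫ θ in 0..π, sin θ ^ m * cos θ = 0 := by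
    simpa using integral_sin_pow_mul_cos_pow_odd (a := 0) (b := π) m 0
  have h2 : ∫ θ in 0..π, sin θ ^ (m + 2) = (m + 1) / (m + 2) * ∫ θ in 0..π, sin θ ^ m := by
    rw [integral_sin_pow]; simp
  calc √2 * (1 - 1 / (2 * (m + 2 : ℕ))) * ∫ θ in 0..π, sin θ ^ m
      = ∫ θ in 0..π, (√2 / 2 * sin θ ^ m - √2 / 2 * (sin θ ^ m * cos θ)
          + √2 / 2 * sin θ ^ (m + 2)) := by
        rw [intervalIntegral.integral_add (Continuous.intervalIntegrable (by fun_prop) _ _)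
          (Continuous.intervalIntegrable (by fun_prop) _ _),
          intervalIntegral.integral_sub (Continuous.intervalIntegrable (by fun_prop) _ _)
          (Continuous.intervalIntegrable (by fun_prop) _ _), intervalIntegral.integral_const_mul,
          intervalIntegral.integral_const_mul, intervalIntegral.integral_const_mul, h0, h2]
        push_cast
        field_simp
        ring
    _ ≤ _ := by
        refine intervalIntegral.integral_mono_on pi_pos.le
          (Continuous.intervalIntegrable (by fun_prop) _ _)
          (Continuous.intervalIntegrable (by fun_prop) _ _) fun θ hθ ↦ ?_
        have hs : 0 ≤ sin θ ^ m := pow_nonneg (sin_nonneg_of_mem_Icc hθ) m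
        have : √2 * (1 - cos θ / 2 - cos θ ^ 2 / 2) ≤ √(2 - 2 * cos θ) := by
          have hc := cos_le_one θ
          have hc' := neg_one_le_cos θ
          rw [show 2 - 2 * cos θ = 2 * (1 - cos θ) by ring, sqrt_mul zero_le_two]
          refine mul_le_mul_of_nonneg_left (le_sqrt_of_sq_le ?_) (sqrt_nonneg _)
          have h3 : 0 ≤ (1 - cos θ) * (cos θ ^ 2 * (3 + cos θ)) :=
            mul_nonneg (by linarith) (mul_nonneg (sq_nonneg _) (by linarith))
          linarith [h3]
        calc _ = sin θ ^ m * (√2 * (1 - cos θ / 2 - cos θ ^ 2 / 2)) := by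
              rw [cos_sq']; ring
          _ ≤ _ := mul_le_mul_of_nonneg_left this hs

theorem tendsto_uniformConst : Tendsto uniformConst atTop (𝓝 √2) := by
  have h : Tendsto (fun d : ℕ ↦ √2 * (1 - 1 / 2 * (1 / (d : ℝ)))) atTop
      (𝓝 (√2 * (1 - 1 / 2 * 0))) :=
    ((tendsto_one_div_atTop_nhds_zero_nat.const_mul _).const_sub _).const_mul _
  rw [mul_zero, sub_zero, mul_one] at h
  refine tendsto_of_tendsto_of_tendsto_of_le_of_le' h tendsto_const_nhds ?_ ?_
  · filter_upwards [eventually_ge_atTop 2] with d hd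
    refine le_of_eq_of_le ?_ (sqrt_two_mul_le_uniformConst hd)
    congr 2
    rw [one_div_mul_one_div]
  · filter_upwards [eventually_ge_atTop 2] with d hd
    exact uniformConst_le_sqrt_two hd

theorem tendsto_one_div_mul_sub (a b d : ℝ) (ha : 0 < a) :
    Tendsto (fun k : ℕ ↦ 1 / (a * (2 * (d + 2 * k) - b))) atTop (𝓝 0) := by
  have h1 : Tendsto (fun k : ℕ ↦ (4 * a) * (k : ℝ) + a * (2 * d - b)) atTop atTop :=
    tendsto_atTop_add_const_right _ _ (tendsto_natCast_atTop_atTop.const_mul_atTop (by positivity))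
  refine (h1.inv_tendsto_atTop).congr fun k ↦ ?_
  rw [Pi.inv_apply, one_div]
  congr 1; ring

theorem tendsto_uniformConst_mul_exp (a b : ℝ) (ha : 0 < a) (d : ℕ) :
    Tendsto (fun k : ℕ ↦ uniformConst (d + 2 * k) * exp (1 / (a * (2 * (d + 2 * k) - b)))) atTop
      (𝓝 √2) := by
  have h1 : Tendsto (fun k : ℕ ↦ d + 2 * k) atTop atTop :=
    tendsto_atTop_mono (fun k ↦ by simp; omega) tendsto_id
  have h := (tendsto_uniformConst.comp h1).mul
    ((continuous_exp.tendsto 0).comp (tendsto_one_div_mul_sub a b d ha))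
  simpa using h

/-- The exponential correction makes the sequence decrease to `√2` along steps of two. The recursion
factor is at most `exp (1 / (4 * x ^ 2 - 1))`, and this exponent is dominated by the telescoping
difference of `1 / (4 * (2 * x - 3))`. -/
theorem sqrt_two_mul_exp_le_uniformConst {d : ℕ} (hd : 2 ≤ d) :
    √2 * exp (-(1 / (4 * (2 * (d : ℝ) - 3)))) ≤ uniformConst d := by
  have hanti : Antitone fun k : ℕ ↦
      uniformConst (d + 2 * k) * exp (1 / (4 * (2 * ((d : ℝ) + 2 * k) - 3))) := by
    refine antitone_nat_of_succ_le fun k ↦ ?_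
    have hx : (2 : ℝ) ≤ d + 2 * k := by
      have : (2 : ℝ) ≤ d := by exact_mod_cast hd
      linarith [(k.cast_nonneg : (0 : ℝ) ≤ k)]
    have hrec := uniformConst_recursion (d := d + 2 * k) (by omega)
    rw [show d + 2 * (k + 1) = d + 2 * k + 2 by ring, hrec]
    push_cast
    rw [show (d : ℝ) + 2 * (k + 1) = (d + 2 * k) + 2 by ring]
    generalize (d : ℝ) + 2 * k = x at hx
    have hpos : 0 < 4 * x ^ 2 - 1 := by nlinarith
    have h1 : 4 * x ^ 2 / (4 * x ^ 2 - 1) ≤ exp (1 / (4 * x ^ 2 - 1)) := by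
      refine le_trans (le_of_eq ?_) (add_one_le_exp _)
      field_simp; ring
    have h2 : 1 / (4 * x ^ 2 - 1) + 1 / (4 * (2 * (x + 2) - 3)) ≤ 1 / (4 * (2 * x - 3)) := by
      have e : 1 / (4 * (2 * x - 3)) - (1 / (4 * x ^ 2 - 1) + 1 / (4 * (2 * (x + 2) - 3)))
          = 2 / ((4 * x ^ 2 - 1) * (2 * x - 3)) := by
        have : 2 * x - 3 ≠ 0 := by linarith
        have : 2 * (x + 2) - 3 ≠ 0 := by linarith
        field_simp
        ring
      have : 0 ≤ 2 / ((4 * x ^ 2 - 1) * (2 * x - 3)) := by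
        have : 0 < 2 * x - 3 := by linarith
        positivity
      linarith
    calc 4 * x ^ 2 / (4 * x ^ 2 - 1) * uniformConst (d + 2 * k) * exp (1 / (4 * (2 * (x + 2) - 3)))
        ≤ exp (1 / (4 * x ^ 2 - 1)) * uniformConst (d + 2 * k)
          * exp (1 / (4 * (2 * (x + 2) - 3))) := by
          have := uniformConst_nonneg (d + 2 * k)
          gcongr
      _ = uniformConst (d + 2 * k) * exp (1 / (4 * x ^ 2 - 1) + 1 / (4 * (2 * (x + 2) - 3))) := by
          rw [exp_add]; ring
      _ ≤ _ := mul_le_mul_of_nonneg_left (exp_le_exp.2 h2) (uniformConst_nonneg _)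
  have h := hanti.le_of_tendsto (tendsto_uniformConst_mul_exp 4 3 (by norm_num) d) 0
  simp only [mul_zero, add_zero, Nat.cast_zero] at h
  rw [exp_neg, ← div_eq_mul_inv]
  exact (div_le_iff₀ (exp_pos _)).2 h

/-- Here the corrected sequence increases to `√2`: the recursion factor is at least `exp (1 / (4 * x
^ 2))`, which outweighs the decrease of the correction. -/
theorem uniformConst_le_sqrt_two_mul_exp {d : ℕ} (hd : 2 ≤ d) :
    uniformConst d ≤ √2 * exp (-(1 / (5 * (2 * (d : ℝ) - 1)))) := by
  have hmono : Monotone fun k : ℕ ↦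
      uniformConst (d + 2 * k) * exp (1 / (5 * (2 * ((d : ℝ) + 2 * k) - 1))) := by
    refine monotone_nat_of_le_succ fun k ↦ ?_
    have hx : (2 : ℝ) ≤ d + 2 * k := by
      have : (2 : ℝ) ≤ d := by exact_mod_cast hd
      linarith [(k.cast_nonneg : (0 : ℝ) ≤ k)]
    have hrec := uniformConst_recursion (d := d + 2 * k) (by omega)
    rw [show d + 2 * (k + 1) = d + 2 * k + 2 by ring, hrec]
    push_cast
    rw [show (d : ℝ) + 2 * (k + 1) = (d + 2 * k) + 2 by ring]
    generalize (d : ℝ) + 2 * k = x at hx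
    have hpos : 0 < 4 * x ^ 2 - 1 := by nlinarith
    have h1 : exp (1 / (4 * x ^ 2)) ≤ 4 * x ^ 2 / (4 * x ^ 2 - 1) := by
      have := add_one_le_exp (-(1 / (4 * x ^ 2)))
      rw [exp_neg] at this
      rw [show -(1 / (4 * x ^ 2)) + 1 = (4 * x ^ 2 - 1) / (4 * x ^ 2) by field_simp; ring,
        le_inv_comm₀ (by positivity) (exp_pos _), inv_div] at this
      exact this
    have h2 : 1 / (5 * (2 * x - 1)) ≤ 1 / (4 * x ^ 2) + 1 / (5 * (2 * (x + 2) - 1)) := by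
      have hp1 : 0 < 2 * x - 1 := by linarith
      have hp2 : 0 < 2 * (x + 2) - 1 := by linarith
      have e : 1 / (4 * x ^ 2) + 1 / (5 * (2 * (x + 2) - 1)) - 1 / (5 * (2 * x - 1))
          = (4 * x ^ 2 + 20 * x - 15) / (20 * x ^ 2 * ((2 * x - 1) * (2 * (x + 2) - 1))) := by
        rw [div_add_div _ _ (by positivity) (by positivity),
          div_sub_div _ _ (by positivity) (by positivity),
          div_eq_div_iff (by positivity) (by positivity)]
        ring
      have : 0 ≤ (4 * x ^ 2 + 20 * x - 15) / (20 * x ^ 2 * ((2 * x - 1) * (2 * (x + 2) - 1))) :=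
        div_nonneg (by nlinarith) (by positivity)
      linarith
    calc uniformConst (d + 2 * k) * exp (1 / (5 * (2 * x - 1)))
        ≤ uniformConst (d + 2 * k) * exp (1 / (4 * x ^ 2) + 1 / (5 * (2 * (x + 2) - 1))) :=
          mul_le_mul_of_nonneg_left (exp_le_exp.2 h2) (uniformConst_nonneg _)
      _ = exp (1 / (4 * x ^ 2)) * uniformConst (d + 2 * k)
          * exp (1 / (5 * (2 * (x + 2) - 1))) := by rw [exp_add]; ring
      _ ≤ _ := by
          have := uniformConst_nonneg (d + 2 * k)
          gcongr
  have h := hmono.ge_of_tendsto (tendsto_uniformConst_mul_exp 5 1 (by norm_num) d) 0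
  simp only [mul_zero, add_zero, Nat.cast_zero] at h
  rw [exp_neg, ← div_eq_mul_inv]
  exact (le_div_iff₀ (exp_pos _)).2 h

theorem one_lt_uniformConst {d : ℕ} (hd : 2 ≤ d) : 1 < uniformConst d := by
  refine lt_of_lt_of_le ?_ (sqrt_two_mul_le_uniformConst hd)
  have hd' : (2 : ℝ) ≤ d := by exact_mod_cast hd
  have h1 : 1 / (2 * (d : ℝ)) ≤ 1 / 4 := by
    apply one_div_le_one_div_of_le <;> linarith
  have h2 : (1.4 : ℝ) < √2 := lt_sqrt_of_sq_lt (by norm_num)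
  nlinarith

theorem uniformConst_lt_two {d : ℕ} (hd : 2 ≤ d) : uniformConst d < 2 := by
  refine (uniformConst_le_sqrt_two hd).trans_lt ?_
  rw [sqrt_lt' two_pos]; norm_num

/-! ### Optimal Steiner centers and the upper bound. -/

theorem sum_dist_le_card_sq_mul_uniformConst {d : ℕ} [NeZero d] {ι : Type*} (s : Finset ι)
    (u : ι → EuclideanSpace ℝ (Fin d)) (hu : ∀ i ∈ s, ‖u i‖ = 1) :
    ∑ i ∈ s, ∑ j ∈ s, dist (u i) (u j) ≤ (s.card : ℝ) ^ 2 * uniformConst d := by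
  have h := sum_dist_le_uniformConst (d := d) (n := s.card)
    fun i ↦ ⟨u (s.equivFin.symm i), by simpa using hu _ (s.equivFin.symm i).2⟩
  simp only [Subtype.dist_eq] at h
  refine le_of_eq_of_le ?_ h
  rw [← Finset.sum_coe_sort s, ← Equiv.sum_comp s.equivFin.symm]
  refine Finset.sum_congr rfl fun i _ ↦ ?_
  rw [← Finset.sum_coe_sort s, ← Equiv.sum_comp s.equivFin.symm]

section
variable {E : Type*} [NormedAddCommGroup E] [InnerProductSpace ℝ E]

/-- If the sum of unit vectors vanishes, then their average distance from a unit vector is at most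
`√2`. -/
theorem sum_dist_le_sqrt_two_mul_card {ι : Type*} (s : Finset ι) (u : ι → E)
    (hu : ∀ i ∈ s, ‖u i‖ = 1) (h0 : ∑ i ∈ s, u i = 0) {v : E} (hv : ‖v‖ = 1) :
    ∑ i ∈ s, dist v (u i) ≤ √2 * s.card := by
  have h2 : √2 * √2 = 2 := mul_self_sqrt zero_le_two
  -- AM-GM, sharp at distance `√2`, replaces the distance by an affine function of `u i`, whose
  -- linear part sums to zero.
  have hi : ∀ i ∈ s, √2 * dist v (u i) ≤ 2 - inner ℝ v (u i) := by
    intro i hi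
    have h1 : dist v (u i) ^ 2 = 2 - 2 * inner ℝ v (u i) := by
      rw [dist_eq_norm, norm_sub_sq_real, hv, hu i hi]; ring
    nlinarith [sq_nonneg (√2 - dist v (u i))]
  have h := Finset.sum_le_sum hi
  rw [← Finset.mul_sum, Finset.sum_sub_distrib, ← inner_sum, h0, inner_zero_right, sub_zero,
    Finset.sum_const, nsmul_eq_mul] at h
  have hpos : 0 < √2 := sqrt_pos.2 two_pos
  nlinarith

/-- The first order condition for a point which minimizes the sum of the distances from the points
of `P` and does not belong to `P`. -/
theorem sum_inv_dist_smul_sub_eq_zero {P : Finset E} {o : E} (ho : o ∉ P)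
    (hmin : ∀ x, ∑ p ∈ P, dist o p ≤ ∑ p ∈ P, dist x p) :
    ∑ p ∈ P, (dist o p)⁻¹ • (p - o) = 0 := by
  set U := ∑ p ∈ P, (dist o p)⁻¹ • (p - o) with hU
  set R := ∑ p ∈ P, (dist o p)⁻¹ with hR
  have hpos : ∀ p ∈ P, 0 < dist o p := fun p hp ↦ dist_pos.2 fun h ↦ ho (h ▸ hp)
  -- Moving `o` by `t • U` and bounding each new distance by AM-GM against the old one gives a
  -- quadratic majorant, exact at `t = 0`, so no differentiation is needed.
  have key : ∀ t : ℝ, 0 ≤ -2 * t * ‖U‖ ^ 2 + t ^ 2 * ‖U‖ ^ 2 * R := by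
    intro t
    have h1 : ∀ p ∈ P, 2 * dist (o + t • U) p ≤
        2 * dist o p - 2 * t * inner ℝ U ((dist o p)⁻¹ • (p - o))
          + t ^ 2 * ‖U‖ ^ 2 * (dist o p)⁻¹ := by
      intro p hp
      have hr := hpos p hp
      have hsq : dist (o + t • U) p ^ 2
          = t ^ 2 * ‖U‖ ^ 2 - 2 * t * inner ℝ U (p - o) + dist o p ^ 2 := by
        rw [dist_comm o p, dist_eq_norm, dist_eq_norm,
          show o + t • U - p = t • U - (p - o) by abel, norm_sub_sq_real, norm_smul,
          real_inner_smul_left, mul_pow, Real.norm_eq_abs, sq_abs]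
        ring
      rw [inner_smul_right]
      have : 2 * dist o p - 2 * t * ((dist o p)⁻¹ * inner ℝ U (p - o))
          + t ^ 2 * ‖U‖ ^ 2 * (dist o p)⁻¹
          = (dist (o + t • U) p ^ 2 + dist o p ^ 2) / dist o p := by
        rw [hsq]; field_simp; ring
      rw [this, le_div_iff₀ hr]
      nlinarith [sq_nonneg (dist (o + t • U) p - dist o p)]
    have h2 := Finset.sum_le_sum h1
    rw [← Finset.mul_sum, Finset.sum_add_distrib, Finset.sum_sub_distrib, ← Finset.mul_sum,
      ← Finset.mul_sum, ← Finset.mul_sum, ← inner_sum, ← hU, ← hR,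
      real_inner_self_eq_norm_sq] at h2
    linarith [hmin (o + t • U)]
  rcases P.eq_empty_or_nonempty with rfl | hne
  · simp [hU]
  have hRpos : 0 < R := Finset.sum_pos (fun p hp ↦ inv_pos.2 (hpos p hp)) hne
  -- `R⁻¹` minimizes the quadratic; this is the Weiszfeld step.
  have h := key R⁻¹
  have e : -2 * R⁻¹ * ‖U‖ ^ 2 + R⁻¹ ^ 2 * ‖U‖ ^ 2 * R = -(R⁻¹ * ‖U‖ ^ 2) := by
    field_simp; ring
  rw [e] at h
  have h3 : 0 < R⁻¹ := inv_pos.2 hRpos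
  have h4 : ‖U‖ ^ 2 ≤ 0 := by
    by_contra hc
    have := mul_pos h3 (not_le.1 hc)
    linarith
  exact norm_eq_zero.1 (pow_eq_zero_iff two_ne_zero |>.1 (le_antisymm h4 (sq_nonneg _)))

theorem dist_smul_smul_le {u v : E} (hu : ‖u‖ = 1) (hv : ‖v‖ = 1) {a r s : ℝ} (ha : 0 ≤ a)
    (hr : a ≤ r) (hs : a ≤ s) :
    dist (r • u) (s • v) ≤ a * dist u v + (r - a) + (s - a) := by
  have e : r • u - s • v = a • (u - v) + (r - a) • u + -((s - a) • v) := by module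
  rw [dist_eq_norm, dist_eq_norm, e]
  refine (norm_add_le _ _).trans (add_le_add ((norm_add_le _ _).trans (add_le_add ?_ ?_)) ?_)
  · rw [norm_smul, Real.norm_of_nonneg ha]
  · rw [norm_smul, hu, Real.norm_of_nonneg (by linarith), mul_one]
  · rw [norm_neg, norm_smul, hv, Real.norm_of_nonneg (by linarith), mul_one]
end

theorem exists_starLength_eq_minSteinerStar {d : ℕ} {P : Finset (EuclideanSpace ℝ (Fin d))}
    (hP : P.Nonempty) :
    ∃ o, starLength P o = minSteinerStar P ∧ ∀ x, starLength P o ≤ starLength P x := by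
  obtain ⟨p, hp⟩ := hP
  have hcont : Continuous (starLength P) := by unfold starLength; fun_prop
  have hlim : Tendsto (starLength P) (cocompact _) atTop := by
    refine tendsto_atTop_mono (fun x ↦ ?_) (tendsto_dist_left_cocompact_atTop p)
    rw [dist_comm]
    exact Finset.single_le_sum (f := fun q ↦ dist x q) (fun _ _ ↦ dist_nonneg) hp
  obtain ⟨o, ho⟩ := hcont.exists_forall_le hlim
  exact ⟨o, le_antisymm (le_ciInf ho) (ciInf_le (bddBelow_range_starLength P) o), ho⟩

theorem mul_minStar_le {d : ℕ} (hd : 2 ≤ d) {P : Finset (EuclideanSpace ℝ (Fin d))}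
    (hP : P.Nonempty) :
    (1 + √2 - uniformConst d) * minStar P hP ≤
      (2 * √2 - uniformConst d) * minSteinerStar P := by
  have : NeZero d := ⟨by omega⟩
  set c := uniformConst d
  have hc2 : c < 2 := uniformConst_lt_two hd
  have hs2 : 1 < √2 := by rw [lt_sqrt zero_le_one]; norm_num
  obtain ⟨o, ho, hmin⟩ := exists_starLength_eq_minSteinerStar hP
  rw [← ho]
  have hT0 := starLength_nonneg P o
  have hle : ∀ p ∈ P, minStar P hP ≤ starLength P p := fun p hp ↦ Finset.inf'_le _ hp
  by_cases hoP : o ∈ P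
  · refine (mul_le_mul_of_nonneg_left (hle o hoP) (by linarith)).trans ?_
    exact mul_le_mul_of_nonneg_right (by linarith) hT0
  have hr : ∀ p ∈ P, 0 < dist o p := fun p hp ↦ dist_pos.2 fun h ↦ hoP (h ▸ hp)
  have h0 := sum_inv_dist_smul_sub_eq_zero hoP hmin
  set u : EuclideanSpace ℝ (Fin d) → EuclideanSpace ℝ (Fin d) :=
    fun p ↦ (dist o p)⁻¹ • (p - o) with hu
  have hu1 : ∀ p ∈ P, ‖u p‖ = 1 := by
    intro p hp
    rw [hu]
    simp only
    rw [norm_smul, ← dist_eq_norm, dist_comm p o, norm_inv, Real.norm_of_nonneg dist_nonneg,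
      inv_mul_cancel₀ (hr p hp).ne']
  have hpu : ∀ p ∈ P, dist o p • u p = p - o := by
    intro p hp
    simp only [hu]
    rw [smul_inv_smul₀ (hr p hp).ne']
  obtain ⟨q, hq, hqmin⟩ := P.exists_min_image (dist o) hP
  set a := dist o q
  set T := starLength P o with hT
  set n : ℝ := (P.card : ℝ)
  have hn : 0 < n := Nat.cast_pos.2 hP.card_pos
  have hdist : ∀ p ∈ P, ∀ p' ∈ P,
      dist p p' ≤ a * dist (u p) (u p') + (dist o p - a) + (dist o p' - a) := by
    intro p hp p' hp'
    have h := dist_smul_smul_le (hu1 p hp) (hu1 p' hp') (hr q hq).le (hqmin p hp) (hqmin p' hp')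
    rwa [hpu p hp, hpu p' hp', dist_sub_right] at h
  have hsum : ∀ p ∈ P,
      starLength P p ≤ a * ∑ p' ∈ P, dist (u p) (u p') + n * (dist o p - a) + (T - n * a) := by
    intro p hp
    refine (Finset.sum_le_sum fun p' hp' ↦ hdist p hp p' hp').trans (le_of_eq ?_)
    rw [Finset.sum_add_distrib, Finset.sum_add_distrib, ← Finset.mul_sum, Finset.sum_const,
      Finset.sum_sub_distrib, Finset.sum_const, nsmul_eq_mul, nsmul_eq_mul, hT, starLength]
  -- Star at the point `q` nearest to `o`, where the excess `dist o q - a` vanishes.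
  have hB1 : minStar P hP ≤ T + (√2 - 1) * (n * a) := by
    have h1 := sum_dist_le_sqrt_two_mul_card P u hu1 h0 (hu1 q hq)
    have h2 := mul_le_mul_of_nonneg_left h1 (hr q hq).le
    have h3 := (hle q hq).trans (hsum q hq)
    rw [sub_self, mul_zero] at h3
    linarith
  -- Average of the stars at all points of `P`.
  have hB2 : minStar P hP ≤ 2 * T + (c - 2) * (n * a) := by
    have h1 := sum_dist_le_card_sq_mul_uniformConst P u hu1
    have h2 := mul_le_mul_of_nonneg_left h1 (hr q hq).le
    have h3 := Finset.sum_le_sum fun p hp ↦ (hle p hp).trans (hsum p hp)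
    rw [Finset.sum_const, nsmul_eq_mul, Finset.sum_add_distrib, Finset.sum_add_distrib,
      ← Finset.mul_sum, ← Finset.mul_sum, Finset.sum_sub_distrib, Finset.sum_const,
      Finset.sum_const, nsmul_eq_mul, nsmul_eq_mul] at h3
    have h4 : ∑ p ∈ P, dist o p = T := rfl
    rw [h4] at h3
    refine le_of_mul_le_mul_left ?_ hn
    have e : n * (2 * T + (c - 2) * (n * a)) =
        a * (n ^ 2 * c) + n * (T - n * a) + n * (T - n * a) := by ring
    rw [e]
    exact h3.trans (by linarith)
  -- The weights `2 - c` and `√2 - 1` eliminate `n * a`.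
  have h1 := mul_le_mul_of_nonneg_left hB1 (by linarith : 0 ≤ 2 - c)
  have h2 := mul_le_mul_of_nonneg_left hB2 (by linarith : 0 ≤ √2 - 1)
  linarith

theorem le_of_mem_starRatios {d : ℕ} (hd : 2 ≤ d) {r : ℝ} (hr : r ∈ starRatios d) :
    r ≤ (2 * √2 - uniformConst d) / (1 + √2 - uniformConst d) := by
  obtain ⟨P, hP, hcard, rfl⟩ := hr
  have hs2 : 1 < √2 := by rw [lt_sqrt zero_le_one]; norm_num
  rw [div_le_div_iff₀ (minSteinerStar_pos hcard) (by linarith [uniformConst_lt_two hd]), mul_comm]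
  exact mul_minStar_le hd hP

/-! ### Bounds and limit for the star Steiner ratio. -/

theorem isLUB_starSteinerRatio {d : ℕ} (hd : 2 ≤ d) :
    IsLUB (starRatios d) (starSteinerRatio d) := by
  obtain ⟨r, hr, -⟩ := exists_mem_starRatios_ge hd le_rfl
  exact isLUB_csSup ⟨r, hr⟩ ⟨_, fun _ h ↦ le_of_mem_starRatios hd h⟩

theorem uniformConst_le_starSteinerRatio {d : ℕ} (hd : 2 ≤ d) :
    uniformConst d ≤ starSteinerRatio d := by
  have h : Tendsto (fun n : ℕ ↦ (1 - 1 / (n : ℝ)) * uniformConst d) atTop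
      (𝓝 ((1 - 0) * uniformConst d)) :=
    (tendsto_one_div_atTop_nhds_zero_nat.const_sub 1).mul_const _
  rw [sub_zero, one_mul] at h
  refine le_of_tendsto h ((eventually_ge_atTop 2).mono fun n hn ↦ ?_)
  obtain ⟨r, hr, hle⟩ := exists_mem_starRatios_ge hd hn
  exact hle.trans ((isLUB_starSteinerRatio hd).1 hr)

theorem starSteinerRatio_le {d : ℕ} (hd : 2 ≤ d) :
    starSteinerRatio d ≤ (2 * √2 - uniformConst d) / (1 + √2 - uniformConst d) :=
  (isLUB_starSteinerRatio hd).2 fun _ h ↦ le_of_mem_starRatios hd h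

/-- The quotient equals `1 + (√2 - 1) / (1 + √2 - c)`. -/
theorem ratio_bound_mono {c c' : ℝ} (h : c ≤ c') (hc' : c' < 1 + √2) :
    (2 * √2 - c) / (1 + √2 - c) ≤ (2 * √2 - c') / (1 + √2 - c') := by
  have hs2 : 1 < √2 := by rw [lt_sqrt zero_le_one]; norm_num
  rw [div_le_div_iff₀ (by linarith) (by linarith)]
  nlinarith

theorem tendsto_starSteinerRatio : Tendsto starSteinerRatio atTop (𝓝 √2) := by
  have h : Tendsto (fun d ↦ (2 * √2 - uniformConst d) / (1 + √2 - uniformConst d)) atTop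
      (𝓝 ((2 * √2 - √2) / (1 + √2 - √2))) :=
    (tendsto_uniformConst.const_sub _).div (tendsto_uniformConst.const_sub _) (by simp)
  rw [show (2 * √2 - √2) / (1 + √2 - √2) = √2 by ring] at h
  refine tendsto_of_tendsto_of_tendsto_of_le_of_le' tendsto_uniformConst h ?_ ?_
  · filter_upwards [eventually_ge_atTop 2] with d hd using uniformConst_le_starSteinerRatio hd
  · filter_upwards [eventually_ge_atTop 2] with d hd using starSteinerRatio_le hd

theorem theorem3 :
    (∀ d : ℕ, 2 ≤ d →
      IsLUB (starRatios d) (starSteinerRatio d) ∧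
      1 < uniformConst d ∧ uniformConst d < 2 ∧
      uniformConst d ≤ starSteinerRatio d ∧
      starSteinerRatio d ≤ (2 * √2 - uniformConst d) / (1 + √2 - uniformConst d) ∧
      uniformConst (d + 2) = 4 * (d : ℝ) ^ 2 / (4 * (d : ℝ) ^ 2 - 1) * uniformConst d ∧
      √2 * exp (-(1 / (4 * (2 * (d : ℝ) - 3)))) ≤ starSteinerRatio d ∧
      starSteinerRatio d ≤
        (2 * √2 - √2 * exp (-(1 / (5 * (2 * (d : ℝ) - 1))))) /
          (1 + √2 - √2 * exp (-(1 / (5 * (2 * (d : ℝ) - 1)))))) ∧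
    Tendsto uniformConst atTop (𝓝 √2) ∧
    Tendsto starSteinerRatio atTop (𝓝 √2) := by
  refine ⟨fun d hd ↦ ⟨isLUB_starSteinerRatio hd, one_lt_uniformConst hd, uniformConst_lt_two hd,
    uniformConst_le_starSteinerRatio hd, starSteinerRatio_le hd, uniformConst_recursion hd,
    (sqrt_two_mul_exp_le_uniformConst hd).trans (uniformConst_le_starSteinerRatio hd),
    (starSteinerRatio_le hd).trans
      (ratio_bound_mono (uniformConst_le_sqrt_two_mul_exp hd) ?_)⟩,
    tendsto_uniformConst, tendsto_starSteinerRatio⟩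
  have hd' : (2 : ℝ) ≤ d := by exact_mod_cast hd
  have hexp : exp (-(1 / (5 * (2 * (d : ℝ) - 1)))) ≤ 1 := by
    rw [exp_le_one_iff, neg_nonpos]
    exact one_div_nonneg.2 (by linarith)
  have := mul_le_mul_of_nonneg_left hexp (sqrt_nonneg 2)
  linarith
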